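/- Let $A$ be a non-empty complete metric space and let $f:\mathbb R^n\times A\to\mathbb R^n$ and $L:\mathbb R^n\times A\to\mathbb R$ be continuous functions such that, for some constants $C,k\ge 0$ and all $x,y\in\mathbb R^n$, $a\in A$, $$|f(x,a)|\le C,\quad |f(x,a)-f(y,a)|\le C|x-y|,\quad 0\le L(x,a)\le 1,\quad |L(x,a)-L(y,a)|\le k|x-y|,$$ and such that, for every $x\in\mathbb R^n$, the set $\{(f(x,a),L(x,a)+r): a\in A,\ r\ge 0\}$ is convex. Let $\mathcal A$ be the set of measurable controls $\alpha:[0,\infty)\to A$ and let $X^x_\alpha$ denote the solution of $X'(t)=f(X(t),\alpha(t))$, $t>0$, $X(0)=x$, in the sense that $X$ is continuous and $X(t)=x+\int_0^t f(X(s),\alpha(s))\,ds$ for all $t\ge0$. Let $\Omega\subset\mathbb R^n$ be a bounded open set such that $\overline\Omega$ is invariant, i.e. $X^x_\alpha(t)\in\overline\Omega$ for all $x\in\overline\Omega$, $\alpha\in\mathcal A$, $t\ge 0$. For $\lambda>0$ let $$V_\lambda(x)=\inf_{\alpha\in\mathcal A}\int_0^\infty e^{-\lambda t}L\big(X^x_\alpha(t),\alpha(t)\big)\,dt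 ,$$ and let $h(x,p)=\sup_{a\in A}\langle f(x,a),p\rangle$ (a maximum whenever it is attained). Proposition 3.1. Let $v^*:\overline\Omega\to\mathbb R$ be a cluster point of $\{\lambda V_\lambda\}_{\lambda>0}$ as $\lambda\to0^+$ for uniform convergence on $\overline\Omega$, i.e. for all $\varepsilon>0$ and $\delta>0$ there is $\lambda\in(0,\delta)$ with $|\lambda V_\lambda(x)-v^*(x)|<\varepsilon$ for all $x\in\overline\Omega$. Then $v^*$ is a viscosity solution of $$h(x,-\nabla v^*(x))=0\quad\text{on }\overline\Omega ,$$ that is, $v^*$ is continuous on $\overline\Omega$ and, for every $x\in\overline\Omega$: (a) (supersolution) $h(x,-p)\ge 0$ for every $p\in\mathbb R^n$ with $\displaystyle\liminf_{\overline\Omega\ni y\to x,\ y\neq x}\frac{v^*(y)-v^*(x)-\langle p,y-x\rangle}{|y-x|}\ge 0$; (b) (subsolution) $h(x,-p)\le 0$ for every $p\in\mathbb R^n$ with $\displaystyle\limsup_{\overline\Omega\ni y\to x,\ y\neq x}\frac{v^*(y)-v^*(x)-\langle p,y-x\rangle}{|y-x|}\le 0$. -/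

import Mathlib

open Set Filter Topology MeasureTheory

noncomputable section

namespace VanishingDiscount

variable {n : ℕ} {A : Type*}

/-- `X` solves the state equation `X' = f (X, α)`, `X 0 = x` on `[0, ∞)` in the Carathéodory
(absolutely continuous) sense, which is the standard one for controls that are only measurable.
For bounded continuous `f` the integrand is bounded and measurable. -/
def IsTrajectory (f : EuclideanSpace ℝ (Fin n) → A → EuclideanSpace ℝ (Fin n))
    (x : EuclideanSpace ℝ (Fin n)) (α : ℝ → A) (X : ℝ → EuclideanSpace ℝ (Fin n)) : Prop :=
  ContinuousOn X (Ici 0) ∧ ∀ t : ℝ, 0 ≤ t → X t = x + ∫ s in (0 : ℝ)..t, f (X s) (α s)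

/-- `K` is invariant: every trajectory issued from `K`, for every measurable control, stays in `K`
for all times `t ≥ 0`. -/
def IsInvariant [MeasurableSpace A]
    (f : EuclideanSpace ℝ (Fin n) → A → EuclideanSpace ℝ (Fin n))
    (K : Set (EuclideanSpace ℝ (Fin n))) : Prop :=
  ∀ x ∈ K, ∀ α : ℝ → A, Measurable α → ∀ X : ℝ → EuclideanSpace ℝ (Fin n),
    IsTrajectory f x α X → ∀ t : ℝ, 0 ≤ t → X t ∈ K

/-- The discounted cost of the state-control pair `(X, α)` with discount rate `lam`. -/
def discountedCost (L : EuclideanSpace ℝ (Fin n) → A → ℝ) (lam : ℝ)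
    (X : ℝ → EuclideanSpace ℝ (Fin n)) (α : ℝ → A) : ℝ :=
  ∫ t in Ioi (0 : ℝ), Real.exp (-lam * t) * L (X t) (α t)

/-- The value function `V_lam`: the infimum of the discounted cost over all measurable controls,
each taken with the corresponding solution of the state equation. -/
def valueFunction [MeasurableSpace A]
    (f : EuclideanSpace ℝ (Fin n) → A → EuclideanSpace ℝ (Fin n))
    (L : EuclideanSpace ℝ (Fin n) → A → ℝ) (lam : ℝ) (x : EuclideanSpace ℝ (Fin n)) : ℝ :=
  sInf {c : ℝ | ∃ (α : ℝ → A) (X : ℝ → EuclideanSpace ℝ (Fin n)),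
    Measurable α ∧ IsTrajectory f x α X ∧ c = discountedCost L lam X α}

/-- `v` is a cluster point, for uniform convergence on `K`, of the family of functions
`(W lam)`, `lam > 0`, as `lam` tends to `0` from the right. -/
def IsUniformClusterPoint (K : Set (EuclideanSpace ℝ (Fin n)))
    (W : ℝ → EuclideanSpace ℝ (Fin n) → ℝ) (v : EuclideanSpace ℝ (Fin n) → ℝ) : Prop :=
  ∀ ε : ℝ, 0 < ε → ∃ᶠ lam in 𝓝[>] (0 : ℝ), ∀ x ∈ K, |W lam x - v x| < ε

/-- The quotient `(V y - V x - ⟨p, y - x⟩) / |y - x|`, as an extended real so that its lower and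
upper limits always make sense. -/
def diffQuotient (V : EuclideanSpace ℝ (Fin n) → ℝ) (x p y : EuclideanSpace ℝ (Fin n)) : EReal :=
  (((V y - V x - inner ℝ p (y - x)) / ‖y - x‖ : ℝ) : EReal)

/-- The subdifferential of `V` at `x` relative to `K`. -/
def subdifferential (K : Set (EuclideanSpace ℝ (Fin n))) (V : EuclideanSpace ℝ (Fin n) → ℝ)
    (x : EuclideanSpace ℝ (Fin n)) : Set (EuclideanSpace ℝ (Fin n)) :=
  {p | 0 ≤ liminf (diffQuotient V x p) (𝓝[K \ {x}] x)}

/-- The superdifferential of `V` at `x` relative to `K`. -/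
def superdifferential (K : Set (EuclideanSpace ℝ (Fin n))) (V : EuclideanSpace ℝ (Fin n) → ℝ)
    (x : EuclideanSpace ℝ (Fin n)) : Set (EuclideanSpace ℝ (Fin n)) :=
  {p | limsup (diffQuotient V x p) (𝓝[K \ {x}] x) ≤ 0}

/-- `V` is a viscosity supersolution on `K` of `F (x, V x, ∇V x) = 0`. -/
def IsViscositySupersolution (K : Set (EuclideanSpace ℝ (Fin n)))
    (F : EuclideanSpace ℝ (Fin n) → ℝ → EuclideanSpace ℝ (Fin n) → ℝ)
    (V : EuclideanSpace ℝ (Fin n) → ℝ) : Prop :=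
  ∀ x ∈ K, ∀ p ∈ subdifferential K V x, 0 ≤ F x (V x) p

/-- `V` is a viscosity subsolution on `K` of `F (x, V x, ∇V x) = 0`. -/
def IsViscositySubsolution (K : Set (EuclideanSpace ℝ (Fin n)))
    (F : EuclideanSpace ℝ (Fin n) → ℝ → EuclideanSpace ℝ (Fin n) → ℝ)
    (V : EuclideanSpace ℝ (Fin n) → ℝ) : Prop :=
  ∀ x ∈ K, ∀ p ∈ superdifferential K V x, F x (V x) p ≤ 0

/-- `V` is a (continuous) viscosity solution on `K` of `F (x, V x, ∇V x) = 0`. -/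
def IsViscositySolution (K : Set (EuclideanSpace ℝ (Fin n)))
    (F : EuclideanSpace ℝ (Fin n) → ℝ → EuclideanSpace ℝ (Fin n) → ℝ)
    (V : EuclideanSpace ℝ (Fin n) → ℝ) : Prop :=
  ContinuousOn V K ∧ IsViscositySupersolution K F V ∧ IsViscositySubsolution K F V

/-- The reduced Hamiltonian `h (x, p) = sup_a ⟨f (x, a), p⟩`. -/
def reducedHamiltonian (f : EuclideanSpace ℝ (Fin n) → A → EuclideanSpace ℝ (Fin n))
    (x p : EuclideanSpace ℝ (Fin n)) : ℝ :=
  ⨆ a : A, inner ℝ (f x a) p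

end VanishingDiscount

end

/-!
The idea: dynamic programming for `lam * V_lam` becomes, as `lam → 0`, the statement that `v` never
decreases along a trajectory and can be kept almost constant along a suitable one; testing these
two properties against semidifferentials gives the two viscosity inequalities.

Since `0 ≤ L ≤ 1`, restarting a state-control pair at time `T` changes `lam * cost` by at most
`lam * T` (`abs_mul_discountedCost_sub_shift_le`). Concatenating trajectories gives
`lam * V_lam x ≤ lam * V_lam (X T) + lam * T` for every trajectory from `x`
(`mul_valueFunction_le_along`), and a nearly optimal trajectory satisfies the reverse inequality up
to `lam * T` and an arbitrarily small error (`exists_trajectory_mul_valueFunction_le`). Letting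
`lam → 0` along the cluster values, `v x ≤ v (X T)` for every trajectory, and for all `T` and
`ε > 0` some trajectory has `v (X T) ≤ v x + ε`.

A trajectory satisfies `X t - x = ∫ f (x, α) + O(t²)`. If `p` is a superdifferential, constant
controls in the first property give `⟨f (x, a), p⟩ ≥ 0` for each `a`
(`isViscositySubsolution_of_le_along`). If `p` is a subdifferential, the second property at time `t`
with `ε = t²` gives `-h (x, -p) t ≤ ∫ ⟨p, f (x, α)⟩ ≤ o(t)`
(`isViscositySupersolution_of_exists_trajectory`).

Continuity of `v` follows from that of `V_lam`, which compares two trajectories driven by the same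
control (`mul_valueFunction_sub_le`). This needs solutions of the state equation for controls that
are only measurable, which Mathlib's Picard-Lindelöf theorem does not cover; `exists_isTrajectory`
produces them from Banach's fixed point theorem.
-/

namespace VanishingDiscount

/-! ### Integrands along a trajectory -/

section Along

variable {n : ℕ} {A F : Type*} [TopologicalSpace A] [MeasurableSpace A] [BorelSpace A]
  [NormedAddCommGroup F] [MeasurableSpace F] [BorelSpace F]

/-- `A` need not be separable, so that the Borel `σ`-algebra of a product with `A` may be larger
than the product `σ`-algebra; measurability comes from `g` being a Carathéodory function. -/
lemma measurable_comp_control {g : EuclideanSpace ℝ (Fin n) → A → F}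
    (hg : Continuous (Function.uncurry g)) {Y : ℝ → EuclideanSpace ℝ (Fin n)} (hY : Measurable Y)
    {α : ℝ → A} (hα : Measurable α) : Measurable fun s => g (Y s) (α s) := by
  have h : Measurable (Function.uncurry g) :=
    measurable_uncurry_of_continuous_of_measurable
      (fun a => hg.comp (continuous_id.prodMk continuous_const))
      (fun y => (hg.comp (continuous_const.prodMk continuous_id)).measurable)
  exact h.comp (hY.prodMk hα)

lemma continuous_comp_max {X : ℝ → EuclideanSpace ℝ (Fin n)} (hX : ContinuousOn X (Ici 0)) :
    Continuous fun s => X (max s 0) :=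
  hX.comp_continuous (by fun_prop) fun s => mem_Ici.2 (le_max_right s 0)

lemma aestronglyMeasurable_along [SecondCountableTopology F]
    {g : EuclideanSpace ℝ (Fin n) → A → F}
    (hg : Continuous (Function.uncurry g)) {X : ℝ → EuclideanSpace ℝ (Fin n)}
    (hX : ContinuousOn X (Ici 0)) {α : ℝ → A} (hα : Measurable α) :
    AEStronglyMeasurable (fun s => g (X s) (α s)) (volume.restrict (Ici 0)) := by
  have h := measurable_comp_control hg (continuous_comp_max hX).measurable hα
  refine h.aestronglyMeasurable.congr ?_
  filter_upwards [ae_restrict_mem measurableSet_Ici] with s hs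
  rw [max_eq_left (mem_Ici.1 hs)]

lemma intervalIntegrable_along [SecondCountableTopology F]
    {g : EuclideanSpace ℝ (Fin n) → A → F}
    (hg : Continuous (Function.uncurry g)) {M : ℝ} (hM : ∀ x a, ‖g x a‖ ≤ M)
    {X : ℝ → EuclideanSpace ℝ (Fin n)} (hX : ContinuousOn X (Ici 0)) {α : ℝ → A}
    (hα : Measurable α) {a b : ℝ} (ha : 0 ≤ a) (hb : 0 ≤ b) :
    IntervalIntegrable (fun s => g (X s) (α s)) volume a b := by
  rw [intervalIntegrable_iff, uIoc]
  refine Integrable.of_bound ?_ M (Eventually.of_forall fun s => hM _ _)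
  exact (aestronglyMeasurable_along hg hX hα).mono_measure
    (Measure.restrict_mono (fun s (hs : s ∈ Ioc _ _) => (le_min ha hb).trans hs.1.le) le_rfl)

end Along

/-! ### Existence and stability of trajectories -/

section Basic

variable {n : ℕ} {A : Type*} {f : EuclideanSpace ℝ (Fin n) → A → EuclideanSpace ℝ (Fin n)}
  {x : EuclideanSpace ℝ (Fin n)} {α : ℝ → A} {X : ℝ → EuclideanSpace ℝ (Fin n)} {C : ℝ}

lemma IsTrajectory.apply_zero (h : IsTrajectory f x α X) : X 0 = x := by
  simpa using h.2 0 le_rfl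

lemma IsTrajectory.norm_sub_le (hf_bdd : ∀ x a, ‖f x a‖ ≤ C)
    (h : IsTrajectory f x α X) {t : ℝ} (ht : 0 ≤ t) : ‖X t - x‖ ≤ C * t := by
  have h1 : ‖∫ s in (0 : ℝ)..t, f (X s) (α s)‖ ≤ C * |t - 0| :=
    intervalIntegral.norm_integral_le_of_norm_le_const fun s _ => hf_bdd _ _
  rwa [sub_zero, abs_of_nonneg ht, ← add_sub_cancel_left x (∫ s in (0 : ℝ)..t, f (X s) (α s)),
    ← h.2 t ht] at h1

end Basic

variable {n : ℕ} {A : Type*} [MetricSpace A] [MeasurableSpace A] [BorelSpace A]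
  {f : EuclideanSpace ℝ (Fin n) → A → EuclideanSpace ℝ (Fin n)} {C : ℝ}

lemma integral_exp_mul_le {M : ℝ} (hM : 0 < M) (t : ℝ) :
    M * ∫ s in (0 : ℝ)..t, Real.exp (2 * M * s) ≤ Real.exp (2 * M * t) / 2 := by
  rw [intervalIntegral.integral_comp_mul_left (fun s => Real.exp s) (by positivity)]
  simp only [integral_exp, mul_zero, Real.exp_zero, smul_eq_mul]
  field_simp
  linarith

/-- For a measurable control the state equation has a solution on all of `[0, ∞)`. In terms of
`Y t = exp (-2 M t) (X t - x)` the equation is a fixed point problem in the space of bounded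
continuous functions, and the exponential weight makes it a contraction of ratio `1 / 2`. -/
theorem exists_isTrajectory (hC : 0 ≤ C) (hf_cont : Continuous (Function.uncurry f))
    (hf_bdd : ∀ x a, ‖f x a‖ ≤ C) (hf_lip : ∀ x y a, ‖f x a - f y a‖ ≤ C * ‖x - y‖)
    (x : EuclideanSpace ℝ (Fin n)) {α : ℝ → A} (hα : Measurable α) :
    ∃ X, IsTrajectory f x α X := by
  -- `C` may vanish, and the weight has to be positive.
  set M : ℝ := C + 1 with hM_def
  have hM : 0 < M := by positivity
  have hCM : C ≤ M := by linarith
  let S : BoundedContinuousFunction ℝ (EuclideanSpace ℝ (Fin n)) → ℝ → EuclideanSpace ℝ (Fin n) :=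
    fun Y s => x + Real.exp (2 * M * s) • Y s
  have hS : ∀ Y, Continuous (S Y) := fun Y => by
    have := Y.continuous
    fun_prop
  have hmeas : ∀ Y, Measurable fun s => f (S Y s) (α s) := fun Y =>
    measurable_comp_control hf_cont (hS Y).measurable hα
  have hint : ∀ Y a b, IntervalIntegrable (fun s => f (S Y s) (α s)) volume a b := by
    intro Y a b
    rw [intervalIntegrable_iff]
    exact Measure.integrableOn_of_bounded (M := C) measure_Ioc_lt_top.ne
      (hmeas Y).aestronglyMeasurable (Eventually.of_forall fun s => hf_bdd _ _)
  let G : BoundedContinuousFunction ℝ (EuclideanSpace ℝ (Fin n)) → ℝ → EuclideanSpace ℝ (Fin n) :=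
    fun Y t => Real.exp (-(2 * M * max t 0)) • ∫ s in (0 : ℝ)..max t 0, f (S Y s) (α s)
  have hGc : ∀ Y, Continuous (G Y) := by
    intro Y
    have h1 : Continuous fun t => ∫ s in (0 : ℝ)..t, f (S Y s) (α s) :=
      intervalIntegral.continuous_primitive (hint Y) 0
    have h2 : Continuous fun t : ℝ => max t 0 := by fun_prop
    exact (by fun_prop : Continuous fun t : ℝ => Real.exp (-(2 * M * max t 0))).smul (h1.comp h2)
  have hGb : ∀ Y t, ‖G Y t‖ ≤ 1 := by
    intro Y t
    set r := max t 0
    have hr : 0 ≤ r := le_max_right _ _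
    have h1 : ‖∫ s in (0 : ℝ)..r, f (S Y s) (α s)‖ ≤ C * |r - 0| :=
      intervalIntegral.norm_integral_le_of_norm_le_const fun s _ => hf_bdd _ _
    rw [sub_zero, abs_of_nonneg hr] at h1
    have h2 : C * r ≤ Real.exp (2 * M * r) := by
      have := Real.add_one_le_exp (2 * M * r)
      nlinarith [mul_le_mul_of_nonneg_right hCM hr, mul_nonneg hM.le hr]
    change ‖Real.exp (-(2 * M * r)) • ∫ s in (0 : ℝ)..r, f (S Y s) (α s)‖ ≤ 1
    rw [norm_smul, Real.norm_eq_abs, Real.abs_exp, Real.exp_neg, inv_mul_le_iff₀ (Real.exp_pos _),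
      mul_one]
    exact h1.trans h2
  let Ψ : BoundedContinuousFunction ℝ (EuclideanSpace ℝ (Fin n)) →
      BoundedContinuousFunction ℝ (EuclideanSpace ℝ (Fin n)) := fun Y =>
    BoundedContinuousFunction.ofNormedAddCommGroup (G Y) (hGc Y) 1 (hGb Y)
  have hΨ : ContractingWith (1 / 2) Ψ := by
    refine ⟨by norm_num [← NNReal.coe_lt_coe], LipschitzWith.of_dist_le_mul fun Y Z => ?_⟩
    rw [BoundedContinuousFunction.dist_le (by positivity)]
    intro t
    set r := max t 0 with hr_def
    have hr : 0 ≤ r := le_max_right _ _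
    have h1 : ‖∫ s in (0 : ℝ)..r, (f (S Y s) (α s) - f (S Z s) (α s))‖ ≤
        ∫ s in (0 : ℝ)..r, M * dist Y Z * Real.exp (2 * M * s) := by
      refine intervalIntegral.norm_integral_le_of_norm_le hr (Eventually.of_forall fun s _ => ?_)
        (Continuous.intervalIntegrable (by fun_prop) _ _)
      refine (hf_lip _ _ _).trans ?_
      have h2 : ‖S Y s - S Z s‖ ≤ Real.exp (2 * M * s) * dist Y Z := by
        simp only [S, add_sub_add_left_eq_sub, ← smul_sub]
        rw [norm_smul, Real.norm_eq_abs, Real.abs_exp, ← dist_eq_norm]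
        gcongr
        exact BoundedContinuousFunction.dist_coe_le_dist s
      calc C * ‖S Y s - S Z s‖ ≤ M * (Real.exp (2 * M * s) * dist Y Z) := by gcongr
        _ = M * dist Y Z * Real.exp (2 * M * s) := by ring
    change dist (G Y t) (G Z t) ≤ _
    simp only [G, ← hr_def]
    rw [dist_eq_norm, ← smul_sub, ← intervalIntegral.integral_sub (hint Y _ _) (hint Z _ _),
      norm_smul, Real.norm_eq_abs, Real.abs_exp, Real.exp_neg, inv_mul_le_iff₀ (Real.exp_pos _)]
    refine h1.trans ?_
    rw [intervalIntegral.integral_const_mul]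
    have h3 := mul_le_mul_of_nonneg_left (integral_exp_mul_le hM r) (dist_nonneg (x := Y) (y := Z))
    push_cast
    linarith
  have hfix := hΨ.fixedPoint_isFixedPt
  set Y := ContractingWith.fixedPoint Ψ hΨ
  refine ⟨S Y, (hS Y).continuousOn, fun t ht => ?_⟩
  have h1 : Y t = G Y t := congrArg (fun Z => Z t) hfix.symm
  simp only [G, max_eq_left ht] at h1
  change x + Real.exp (2 * M * t) • Y t = _
  rw [h1, smul_smul, ← Real.exp_add, add_neg_cancel, Real.exp_zero, one_smul]

/-- Two trajectories driven by the same control separate at most exponentially. -/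
theorem IsTrajectory.norm_sub_le_exp (hC : 0 ≤ C) (hf_cont : Continuous (Function.uncurry f))
    (hf_bdd : ∀ x a, ‖f x a‖ ≤ C) (hf_lip : ∀ x y a, ‖f x a - f y a‖ ≤ C * ‖x - y‖)
    {x y : EuclideanSpace ℝ (Fin n)} {α : ℝ → A} (hα : Measurable α)
    {X Y : ℝ → EuclideanSpace ℝ (Fin n)} (hX : IsTrajectory f x α X) (hY : IsTrajectory f y α Y)
    {t : ℝ} (ht : 0 ≤ t) : ‖X t - Y t‖ ≤ ‖x - y‖ * Real.exp (C * t) := by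
  -- Gronwall's lemma in Mathlib is differential, so it is applied to the differentiable bound `φ`.
  let d : ℝ → ℝ := fun s => ‖X (max s 0) - Y (max s 0)‖
  have hd : Continuous d := ((continuous_comp_max hX.1).sub (continuous_comp_max hY.1)).norm
  let φ : ℝ → ℝ := fun t => ‖x - y‖ + C * ∫ s in (0 : ℝ)..t, d s
  have hφ : ∀ t, HasDerivAt φ (C * d t) t := fun t =>
    ((hd.integral_hasStrictDerivAt 0 t).hasDerivAt.const_mul C).const_add _
  have hdφ : ∀ s, 0 ≤ s → ‖X s - Y s‖ ≤ φ s := by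
    intro s hs
    have hiX := intervalIntegrable_along hf_cont hf_bdd hX.1 hα le_rfl hs
    have hiY := intervalIntegrable_along hf_cont hf_bdd hY.1 hα le_rfl hs
    have h1 : X s - Y s = (x - y) + ∫ r in (0 : ℝ)..s, (f (X r) (α r) - f (Y r) (α r)) := by
      rw [intervalIntegral.integral_sub hiX hiY, hX.2 s hs, hY.2 s hs]
      abel
    have h2 : ‖∫ r in (0 : ℝ)..s, (f (X r) (α r) - f (Y r) (α r))‖ ≤ ∫ r in (0 : ℝ)..s, C * d r := by
      refine intervalIntegral.norm_integral_le_of_norm_le hs (Eventually.of_forall fun r hr => ?_)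
        ((hd.const_mul C).intervalIntegrable _ _)
      simp only [d, max_eq_left hr.1.le]
      exact hf_lip _ _ _
    rw [h1]
    rw [intervalIntegral.integral_const_mul] at h2
    exact (norm_add_le _ _).trans (add_le_add le_rfl h2)
  have h := norm_le_gronwallBound_of_norm_deriv_right_le (f := φ) (f' := fun s => C * d s)
    (δ := ‖x - y‖) (K := C) (ε := 0) (a := 0) (b := t)
    (fun s _ => (hφ s).continuousAt.continuousWithinAt)
    (fun s _ => (hφ s).hasDerivWithinAt) (by simp [φ])
    (fun s hs => by
      have h1 := hdφ s hs.1
      have h2 : d s = ‖X s - Y s‖ := by simp only [d, max_eq_left hs.1]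
      rw [norm_mul, Real.norm_of_nonneg hC, add_zero, h2, norm_norm]
      exact mul_le_mul_of_nonneg_left (h1.trans (le_abs_self _)) hC)
    t ⟨ht, le_rfl⟩
  rw [gronwallBound_ε0, sub_zero] at h
  exact ((hdφ t ht).trans (le_abs_self _)).trans h

/-! ### Shifting and concatenating trajectories -/

section Concat

variable {B : Type*}

/-- The path that follows `u` up to and including time `T`, and then `w` restarted at time `T`. -/
noncomputable def concat (T : ℝ) (u w : ℝ → B) : ℝ → B :=
  fun s => if s ≤ T then u s else w (s - T)

lemma concat_of_le {T s : ℝ} (u w : ℝ → B) (h : s ≤ T) : concat T u w s = u s := if_pos h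

lemma concat_of_lt {T s : ℝ} (u w : ℝ → B) (h : T < s) : concat T u w s = w (s - T) :=
  if_neg h.not_ge

lemma concat_add {T s : ℝ} (u w : ℝ → B) (h : 0 < s) : concat T u w (s + T) = w s := by
  rw [concat_of_lt u w (by linarith), add_sub_cancel_right]

lemma measurable_concat [MeasurableSpace B] {T : ℝ} {u w : ℝ → B} (hu : Measurable u)
    (hw : Measurable w) : Measurable (concat T u w) :=
  hu.ite measurableSet_Iic (hw.comp (measurable_id.sub_const T))

lemma continuousOn_concat {n : ℕ} {T : ℝ} (hT : 0 ≤ T) {X Y : ℝ → EuclideanSpace ℝ (Fin n)}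
    (hX : ContinuousOn X (Ici 0)) (hY : ContinuousOn Y (Ici 0)) (h : Y 0 = X T) :
    ContinuousOn (concat T X Y) (Ici 0) := by
  have h1 : ContinuousOn (fun s => X (min s T)) (Ici 0) :=
    hX.comp (by fun_prop) fun s hs => mem_Ici.2 (le_min (mem_Ici.1 hs) hT)
  have h2 : Continuous fun s => Y (max (s - T) 0) :=
    (continuous_comp_max hY).comp (continuous_id.sub continuous_const)
  refine ((h1.add h2.continuousOn).sub (continuousOn_const (c := X T))).congr fun s _ => ?_
  rcases le_or_gt s T with hs | hs
  · simp [concat_of_le X Y hs, min_eq_left hs, max_eq_right (sub_nonpos.2 hs), h]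
  · simp [concat_of_lt X Y hs, min_eq_right hs.le, max_eq_left (sub_pos.2 hs).le]

end Concat

lemma IsTrajectory.shift (hf_cont : Continuous (Function.uncurry f))
    (hf_bdd : ∀ x a, ‖f x a‖ ≤ C) {x : EuclideanSpace ℝ (Fin n)} {α : ℝ → A} (hα : Measurable α)
    {X : ℝ → EuclideanSpace ℝ (Fin n)} (hX : IsTrajectory f x α X) {T : ℝ} (hT : 0 ≤ T) :
    IsTrajectory f (X T) (fun s => α (s + T)) fun s => X (s + T) := by
  refine ⟨hX.1.comp (by fun_prop) fun s hs => mem_Ici.2 (add_nonneg (mem_Ici.1 hs) hT),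
    fun t ht => ?_⟩
  have htT : 0 ≤ t + T := add_nonneg ht hT
  change X (t + T) = _
  rw [intervalIntegral.integral_comp_add_right (fun s => f (X s) (α s)), zero_add, hX.2 _ htT,
    hX.2 _ hT, add_assoc, intervalIntegral.integral_add_adjacent_intervals
      (intervalIntegrable_along hf_cont hf_bdd hX.1 hα le_rfl hT)
      (intervalIntegrable_along hf_cont hf_bdd hX.1 hα hT htT)]

lemma IsTrajectory.concat (hf_cont : Continuous (Function.uncurry f))
    (hf_bdd : ∀ x a, ‖f x a‖ ≤ C) {x : EuclideanSpace ℝ (Fin n)} {α β : ℝ → A}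
    (hα : Measurable α) (hβ : Measurable β) {X Y : ℝ → EuclideanSpace ℝ (Fin n)} {T : ℝ}
    (hT : 0 ≤ T) (hX : IsTrajectory f x α X) (hY : IsTrajectory f (X T) β Y) :
    IsTrajectory f x (concat T α β) (concat T X Y) := by
  have hc := continuousOn_concat hT hX.1 hY.1 hY.apply_zero
  have hle : ∀ t, 0 ≤ t → t ≤ T → ∫ s in (0 : ℝ)..t,
      f (VanishingDiscount.concat T X Y s) (VanishingDiscount.concat T α β s) =
        ∫ s in (0 : ℝ)..t, f (X s) (α s) := by
    intro t ht htT
    refine intervalIntegral.integral_congr fun s hs => ?_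
    rw [uIcc_of_le ht] at hs
    simp only [concat_of_le _ _ (hs.2.trans htT)]
  refine ⟨hc, fun t ht => ?_⟩
  rcases le_or_gt t T with htT | htT
  · rw [hle t ht htT, concat_of_le _ _ htT, hX.2 t ht]
  · have hi := fun {a b : ℝ} => intervalIntegrable_along hf_cont hf_bdd hc
      (measurable_concat (T := T) hα hβ) (a := a) (b := b)
    have h1 : ∫ s in T..t,
        f (VanishingDiscount.concat T X Y s) (VanishingDiscount.concat T α β s) =
          ∫ s in (0 : ℝ)..t - T, f (Y s) (β s) := by
      have h2 := intervalIntegral.integral_comp_add_right (a := 0) (b := t - T) (fun s =>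
        f (VanishingDiscount.concat T X Y s) (VanishingDiscount.concat T α β s)) T
      rw [zero_add, sub_add_cancel] at h2
      rw [← h2]
      refine intervalIntegral.integral_congr_ae (Eventually.of_forall fun s hs => ?_)
      rw [uIoc_of_le (sub_pos.2 htT).le] at hs
      simp only [concat_add _ _ hs.1]
    rw [concat_of_lt _ _ htT, ← intervalIntegral.integral_add_adjacent_intervals (hi le_rfl hT)
      (hi hT ht), hle T hT le_rfl, h1, hY.2 _ (sub_pos.2 htT).le, hX.2 T hT, add_assoc]

/-! ### The discounted cost -/

variable {L : EuclideanSpace ℝ (Fin n) → A → ℝ} {lam : ℝ}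

lemma integrableOn_discounted (hL_cont : Continuous (Function.uncurry L))
    (hL_bdd : ∀ x a, 0 ≤ L x a ∧ L x a ≤ 1) (hlam : 0 < lam)
    {α : ℝ → A} (hα : Measurable α) {X : ℝ → EuclideanSpace ℝ (Fin n)}
    (hX : ContinuousOn X (Ici 0)) :
    IntegrableOn (fun t => Real.exp (-lam * t) * L (X t) (α t)) (Ioi 0) := by
  refine Integrable.mono' (integrableOn_exp_mul_Ioi (neg_lt_zero.2 hlam) 0) ?_
    (Eventually.of_forall fun t => ?_)
  · have h1 : Continuous fun t : ℝ => Real.exp (-lam * t) := by fun_prop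
    exact h1.aestronglyMeasurable.mul ((aestronglyMeasurable_along hL_cont hX hα).mono_measure
      (Measure.restrict_mono Ioi_subset_Ici_self le_rfl))
  · obtain ⟨h0, h1⟩ := hL_bdd (X t) (α t)
    rw [norm_mul, Real.norm_eq_abs, Real.abs_exp, Real.norm_of_nonneg h0]
    exact mul_le_of_le_one_right (Real.exp_pos _).le h1

lemma discountedCost_nonneg {A : Type*} {L : EuclideanSpace ℝ (Fin n) → A → ℝ}
    (hL_bdd : ∀ x a, 0 ≤ L x a ∧ L x a ≤ 1) (α : ℝ → A)
    (X : ℝ → EuclideanSpace ℝ (Fin n)) : 0 ≤ discountedCost L lam X α :=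
  integral_nonneg fun t => mul_nonneg (Real.exp_pos _).le (hL_bdd (X t) (α t)).1

lemma mul_discountedCost_le_one (hL_cont : Continuous (Function.uncurry L))
    (hL_bdd : ∀ x a, 0 ≤ L x a ∧ L x a ≤ 1) (hlam : 0 < lam)
    {α : ℝ → A} (hα : Measurable α) {X : ℝ → EuclideanSpace ℝ (Fin n)}
    (hX : ContinuousOn X (Ici 0)) : lam * discountedCost L lam X α ≤ 1 := by
  have h : discountedCost L lam X α ≤ ∫ t in Ioi (0 : ℝ), Real.exp (-lam * t) :=
    integral_mono (integrableOn_discounted hL_cont hL_bdd hlam hα hX)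
      (integrableOn_exp_mul_Ioi (neg_lt_zero.2 hlam) 0) fun t =>
        mul_le_of_le_one_right (Real.exp_pos _).le (hL_bdd (X t) (α t)).2
  rw [integral_exp_mul_Ioi (neg_lt_zero.2 hlam)] at h
  calc lam * discountedCost L lam X α ≤ lam * (-Real.exp (-lam * 0) / -lam) := by gcongr
    _ = 1 := by
      rw [mul_zero, Real.exp_zero]
      field_simp

/-- The cost of the pair `(X, α)` is the cost up to time `T` plus the discounted cost of the pair
restarted at time `T`. -/
lemma discountedCost_eq_add (hL_cont : Continuous (Function.uncurry L))
    (hL_bdd : ∀ x a, 0 ≤ L x a ∧ L x a ≤ 1) (hlam : 0 < lam)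
    {α : ℝ → A} (hα : Measurable α) {X : ℝ → EuclideanSpace ℝ (Fin n)}
    (hX : ContinuousOn X (Ici 0)) {T : ℝ} (hT : 0 ≤ T) :
    discountedCost L lam X α = (∫ t in (0 : ℝ)..T, Real.exp (-lam * t) * L (X t) (α t)) +
      Real.exp (-lam * T) * discountedCost L lam (fun s => X (s + T)) fun s => α (s + T) := by
  have hi := integrableOn_discounted hL_cont hL_bdd hlam hα hX
  have h1 := intervalIntegral.integral_interval_add_Ioi hi (hi.mono_set (Ioi_subset_Ioi hT))
  have h2 : ∫ t in Ioi T, Real.exp (-lam * t) * L (X t) (α t) =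
      Real.exp (-lam * T) * discountedCost L lam (fun s => X (s + T)) fun s => α (s + T) := by
    have h3 := (measurePreserving_add_right volume T).setIntegral_preimage_emb
      (measurableEmbedding_addRight T) (fun t => Real.exp (-lam * t) * L (X t) (α t)) (Ioi T)
    rw [← h3, discountedCost, ← integral_const_mul]
    simp only [preimage_add_const_Ioi, sub_self]
    refine setIntegral_congr_fun measurableSet_Ioi fun t _ => ?_
    rw [← mul_assoc, ← Real.exp_add]
    ring_nf
  rw [discountedCost, ← h1, h2]

lemma intervalIntegrable_discounted (hL_cont : Continuous (Function.uncurry L))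
    (hL_bdd : ∀ x a, 0 ≤ L x a ∧ L x a ≤ 1) (hlam : 0 < lam)
    {α : ℝ → A} (hα : Measurable α) {X : ℝ → EuclideanSpace ℝ (Fin n)}
    (hX : ContinuousOn X (Ici 0)) {T : ℝ} (hT : 0 ≤ T) :
    IntervalIntegrable (fun t => Real.exp (-lam * t) * L (X t) (α t)) volume 0 T :=
  (intervalIntegrable_iff_integrableOn_Ioc_of_le hT).2
    ((integrableOn_discounted hL_cont hL_bdd hlam hα hX).mono_set Ioc_subset_Ioi_self)

/-- Restarting at time `T` changes the normalized cost by at most `lam * T`. -/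
lemma abs_mul_discountedCost_sub_shift_le (hL_cont : Continuous (Function.uncurry L))
    (hL_bdd : ∀ x a, 0 ≤ L x a ∧ L x a ≤ 1) (hlam : 0 < lam)
    {α : ℝ → A} (hα : Measurable α) {X : ℝ → EuclideanSpace ℝ (Fin n)}
    (hX : ContinuousOn X (Ici 0)) {T : ℝ} (hT : 0 ≤ T) :
    |lam * discountedCost L lam X α -
      lam * discountedCost L lam (fun s => X (s + T)) fun s => α (s + T)| ≤ lam * T := by
  have h0 := discountedCost_nonneg (lam := lam) hL_bdd (fun s => α (s + T)) fun s => X (s + T)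
  have h1 := mul_discountedCost_le_one hL_cont hL_bdd hlam
    (hα.comp (measurable_id.add_const T)) (X := fun s => X (s + T))
    (hX.comp (by fun_prop) fun s hs => mem_Ici.2 (add_nonneg (mem_Ici.1 hs) hT))
  simp only [Function.comp_def, id_eq] at h1
  rw [discountedCost_eq_add hL_cont hL_bdd hlam hα hX hT]
  set c := discountedCost L lam (fun s => X (s + T)) fun s => α (s + T)
  have hI0 : 0 ≤ ∫ t in (0 : ℝ)..T, Real.exp (-lam * t) * L (X t) (α t) :=
    intervalIntegral.integral_nonneg hT fun t _ =>
      mul_nonneg (Real.exp_pos _).le (hL_bdd (X t) (α t)).1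
  have hI1 : ∫ t in (0 : ℝ)..T, Real.exp (-lam * t) * L (X t) (α t) ≤ ∫ t in (0 : ℝ)..T, 1 := by
    refine intervalIntegral.integral_mono_on hT
      (intervalIntegrable_discounted hL_cont hL_bdd hlam hα hX hT) intervalIntegrable_const
      fun t ht => mul_le_one₀ (Real.exp_le_one_iff.2 ?_) (hL_bdd (X t) (α t)).1
        (hL_bdd (X t) (α t)).2
    nlinarith [ht.1]
  simp only [intervalIntegral.integral_const, sub_zero, smul_eq_mul, mul_one] at hI1
  set I := ∫ t in (0 : ℝ)..T, Real.exp (-lam * t) * L (X t) (α t)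
  have he0 := Real.add_one_le_exp (-lam * T)
  have he1 : Real.exp (-lam * T) ≤ 1 := Real.exp_le_one_iff.2 (by nlinarith)
  set e := Real.exp (-lam * T)
  have hlc : 0 ≤ lam * c := mul_nonneg hlam.le h0
  have hlI : lam * I ≤ lam * T := by gcongr
  have hlI0 : 0 ≤ lam * I := mul_nonneg hlam.le hI0
  rw [abs_le]
  constructor <;> nlinarith

/-! ### The value function and dynamic programming -/

lemma valueFunction_le {A : Type*} [MeasurableSpace A]
    {f : EuclideanSpace ℝ (Fin n) → A → EuclideanSpace ℝ (Fin n)}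
    {L : EuclideanSpace ℝ (Fin n) → A → ℝ} (hL_bdd : ∀ x a, 0 ≤ L x a ∧ L x a ≤ 1) {x : EuclideanSpace ℝ (Fin n)}
    {α : ℝ → A} (hα : Measurable α) {X : ℝ → EuclideanSpace ℝ (Fin n)}
    (hX : IsTrajectory f x α X) : valueFunction f L lam x ≤ discountedCost L lam X α := by
  refine csInf_le ⟨0, ?_⟩ ⟨α, X, hα, hX, rfl⟩
  rintro _ ⟨β, Y, -, -, rfl⟩
  exact discountedCost_nonneg hL_bdd β Y

lemma exists_mul_discountedCost_lt [Nonempty A] (hC : 0 ≤ C)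
    (hf_cont : Continuous (Function.uncurry f))
    (hf_bdd : ∀ x a, ‖f x a‖ ≤ C) (hf_lip : ∀ x y a, ‖f x a - f y a‖ ≤ C * ‖x - y‖)
    (hlam : 0 < lam) (x : EuclideanSpace ℝ (Fin n)) {η : ℝ} (hη : 0 < η) :
    ∃ α X, Measurable α ∧ IsTrajectory f x α X ∧
      lam * discountedCost L lam X α < lam * valueFunction f L lam x + η := by
  have hne : {c : ℝ | ∃ (α : ℝ → A) (X : ℝ → EuclideanSpace ℝ (Fin n)),
      Measurable α ∧ IsTrajectory f x α X ∧ c = discountedCost L lam X α}.Nonempty := by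
    obtain ⟨a⟩ := ‹Nonempty A›
    obtain ⟨X, hX⟩ := exists_isTrajectory hC hf_cont hf_bdd hf_lip x (measurable_const (a := a))
    exact ⟨_, _, X, measurable_const, hX, rfl⟩
  obtain ⟨_, ⟨α, X, hα, hX, rfl⟩, h⟩ := exists_lt_of_csInf_lt hne
    (lt_add_of_pos_right (valueFunction f L lam x) (div_pos hη hlam))
  refine ⟨α, X, hα, hX, ?_⟩
  calc lam * discountedCost L lam X α < lam * (valueFunction f L lam x + η / lam) := by gcongr
    _ = lam * valueFunction f L lam x + η := by field_simp

/-- The half of the dynamic programming principle that holds along every trajectory. -/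
lemma mul_valueFunction_le_along [Nonempty A] (hC : 0 ≤ C)
    (hf_cont : Continuous (Function.uncurry f))
    (hf_bdd : ∀ x a, ‖f x a‖ ≤ C) (hf_lip : ∀ x y a, ‖f x a - f y a‖ ≤ C * ‖x - y‖)
    (hL_cont : Continuous (Function.uncurry L)) (hL_bdd : ∀ x a, 0 ≤ L x a ∧ L x a ≤ 1)
    (hlam : 0 < lam) {x : EuclideanSpace ℝ (Fin n)} {α : ℝ → A} (hα : Measurable α)
    {X : ℝ → EuclideanSpace ℝ (Fin n)} (hX : IsTrajectory f x α X) {T : ℝ} (hT : 0 ≤ T) :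
    lam * valueFunction f L lam x ≤ lam * valueFunction f L lam (X T) + lam * T := by
  refine le_of_forall_pos_le_add fun η hη => ?_
  obtain ⟨β, Y, hβ, hY, hlt⟩ :=
    exists_mul_discountedCost_lt (L := L) hC hf_cont hf_bdd hf_lip hlam (X T) hη
  have hZ := hX.concat hf_cont hf_bdd hα hβ hT hY
  have h1 := mul_le_mul_of_nonneg_left
    (valueFunction_le (lam := lam) hL_bdd (measurable_concat hα hβ) hZ) hlam.le
  have h2 := (abs_le.1 (abs_mul_discountedCost_sub_shift_le hL_cont hL_bdd hlam
    (measurable_concat (T := T) hα hβ) hZ.1 hT)).2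
  have h3 : (discountedCost L lam (fun s => concat T X Y (s + T)) fun s => concat T α β (s + T)) =
      discountedCost L lam Y β :=
    setIntegral_congr_fun measurableSet_Ioi fun t ht => by simp only [concat_add _ _ (mem_Ioi.1 ht)]
  rw [h3] at h2
  linarith

/-- The half of the dynamic programming principle that holds along nearly optimal trajectories. -/
lemma exists_trajectory_mul_valueFunction_le [Nonempty A] (hC : 0 ≤ C)
    (hf_cont : Continuous (Function.uncurry f))
    (hf_bdd : ∀ x a, ‖f x a‖ ≤ C) (hf_lip : ∀ x y a, ‖f x a - f y a‖ ≤ C * ‖x - y‖)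
    (hL_cont : Continuous (Function.uncurry L)) (hL_bdd : ∀ x a, 0 ≤ L x a ∧ L x a ≤ 1)
    (hlam : 0 < lam) (x : EuclideanSpace ℝ (Fin n)) {T : ℝ} (hT : 0 ≤ T) {η : ℝ} (hη : 0 < η) :
    ∃ α X, Measurable α ∧ IsTrajectory f x α X ∧
      lam * valueFunction f L lam (X T) ≤ lam * valueFunction f L lam x + lam * T + η := by
  obtain ⟨α, X, hα, hX, hlt⟩ :=
    exists_mul_discountedCost_lt (L := L) hC hf_cont hf_bdd hf_lip hlam x hη
  refine ⟨α, X, hα, hX, ?_⟩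
  have h1 := mul_le_mul_of_nonneg_left (valueFunction_le (lam := lam) hL_bdd
    (hα.comp (measurable_id.add_const T)) (hX.shift hf_cont hf_bdd hα hT)) hlam.le
  have h2 := (abs_le.1 (abs_mul_discountedCost_sub_shift_le hL_cont hL_bdd hlam hα hX.1 hT)).1
  simp only [Function.comp_def, id_eq] at h1
  linarith

/-- The modulus of continuity of the normalized value function: trajectories are compared up to
time `T`, and the costs after `T` differ by at most `exp (-lam * T) / lam`. -/
lemma mul_valueFunction_sub_le [Nonempty A] (hC : 0 ≤ C) {k : ℝ} (hk : 0 ≤ k)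
    (hf_cont : Continuous (Function.uncurry f))
    (hf_bdd : ∀ x a, ‖f x a‖ ≤ C) (hf_lip : ∀ x y a, ‖f x a - f y a‖ ≤ C * ‖x - y‖)
    (hL_cont : Continuous (Function.uncurry L)) (hL_bdd : ∀ x a, 0 ≤ L x a ∧ L x a ≤ 1)
    (hL_lip : ∀ x y a, |L x a - L y a| ≤ k * ‖x - y‖)
    (hlam : 0 < lam) (x y : EuclideanSpace ℝ (Fin n)) {T : ℝ} (hT : 0 ≤ T) :
    lam * valueFunction f L lam y - lam * valueFunction f L lam x ≤
      lam * (k * (‖x - y‖ * Real.exp (C * T)) * T) + Real.exp (-lam * T) := by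
  refine le_of_forall_pos_le_add fun η hη => ?_
  obtain ⟨α, X, hα, hX, hlt⟩ :=
    exists_mul_discountedCost_lt (L := L) hC hf_cont hf_bdd hf_lip hlam x hη
  obtain ⟨Y, hY⟩ := exists_isTrajectory hC hf_cont hf_bdd hf_lip y hα
  have hV := mul_le_mul_of_nonneg_left (valueFunction_le (lam := lam) hL_bdd hα hY) hlam.le
  have hI : (∫ t in (0 : ℝ)..T, Real.exp (-lam * t) * L (Y t) (α t)) -
      (∫ t in (0 : ℝ)..T, Real.exp (-lam * t) * L (X t) (α t)) ≤
        k * (‖x - y‖ * Real.exp (C * T)) * T := by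
    rw [← intervalIntegral.integral_sub
      (intervalIntegrable_discounted hL_cont hL_bdd hlam hα hY.1 hT)
      (intervalIntegrable_discounted hL_cont hL_bdd hlam hα hX.1 hT)]
    have h := intervalIntegral.norm_integral_le_of_norm_le_const (a := 0) (b := T)
      (f := fun t => Real.exp (-lam * t) * L (Y t) (α t) - Real.exp (-lam * t) * L (X t) (α t))
      (C := k * (‖x - y‖ * Real.exp (C * T))) fun t ht => by
        rw [uIoc_of_le hT] at ht
        have h1 : Real.exp (-lam * t) ≤ 1 := Real.exp_le_one_iff.2 (by nlinarith [ht.1])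
        have h2 := hX.norm_sub_le_exp hC hf_cont hf_bdd hf_lip hα hY ht.1.le
        have h3 : |L (Y t) (α t) - L (X t) (α t)| ≤ k * (‖x - y‖ * Real.exp (C * T)) := by
          rw [abs_sub_comm]
          refine (hL_lip _ _ _).trans (mul_le_mul_of_nonneg_left (h2.trans ?_) hk)
          gcongr
          exact ht.2
        rw [← mul_sub, norm_mul, Real.norm_eq_abs, Real.abs_exp]
        exact (mul_le_of_le_one_left (abs_nonneg _) h1).trans h3
    rw [sub_zero, abs_of_nonneg hT] at h
    exact (le_abs_self _).trans h
  have hlI := mul_le_mul_of_nonneg_left hI hlam.le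
  have hαT : Measurable fun s => α (s + T) := hα.comp (measurable_id.add_const T)
  have h0 := mul_nonneg hlam.le
    (discountedCost_nonneg (lam := lam) hL_bdd (fun s => α (s + T)) fun s => X (s + T))
  have h1 := mul_discountedCost_le_one hL_cont hL_bdd hlam hαT
    (hY.shift hf_cont hf_bdd hα hT).1
  rw [discountedCost_eq_add hL_cont hL_bdd hlam hα hY.1 hT] at hV
  rw [discountedCost_eq_add hL_cont hL_bdd hlam hα hX.1 hT] at hlt
  have he := Real.exp_pos (-lam * T)
  have h2 := mul_le_mul_of_nonneg_left (sub_le_sub h1 h0) he.le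
  rw [mul_sub] at hlI
  rw [mul_add] at hV hlt
  rw [mul_sub, sub_zero, mul_one] at h2
  linarith

lemma continuous_mul_valueFunction [Nonempty A] (hC : 0 ≤ C) {k : ℝ} (hk : 0 ≤ k)
    (hf_cont : Continuous (Function.uncurry f))
    (hf_bdd : ∀ x a, ‖f x a‖ ≤ C) (hf_lip : ∀ x y a, ‖f x a - f y a‖ ≤ C * ‖x - y‖)
    (hL_cont : Continuous (Function.uncurry L)) (hL_bdd : ∀ x a, 0 ≤ L x a ∧ L x a ≤ 1)
    (hL_lip : ∀ x y a, |L x a - L y a| ≤ k * ‖x - y‖) (hlam : 0 < lam) :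
    Continuous fun x => lam * valueFunction f L lam x := by
  refine continuous_iff_continuousAt.2 fun x => Metric.tendsto_nhds.2 fun ε hε => ?_
  have hT : ∀ᶠ T : ℝ in atTop, Real.exp (-lam * T) < ε := by
    refine (Real.tendsto_exp_atBot.comp ?_).eventually_lt_const hε
    exact tendsto_id.const_mul_atTop_of_neg (neg_lt_zero.2 hlam)
  obtain ⟨T, hTε, hT0⟩ := (hT.and (eventually_ge_atTop 0)).exists
  have hcont : Continuous fun y : EuclideanSpace ℝ (Fin n) =>
      lam * (k * (‖x - y‖ * Real.exp (C * T)) * T) + Real.exp (-lam * T) := by fun_prop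
  have hev := (hcont.tendsto x).eventually_lt_const (by simpa using hTε)
  filter_upwards [hev] with y hy
  rw [Real.dist_eq, abs_lt]
  have h1 := mul_valueFunction_sub_le hC hk hf_cont hf_bdd hf_lip hL_cont hL_bdd hL_lip hlam x y hT0
  have h2 := mul_valueFunction_sub_le hC hk hf_cont hf_bdd hf_lip hL_cont hL_bdd hL_lip hlam y x hT0
  rw [norm_sub_rev y x] at h2
  constructor <;> linarith

/-! ### Semidifferentials -/

section Semidifferential

variable {n : ℕ} {K : Set (EuclideanSpace ℝ (Fin n))} {V : EuclideanSpace ℝ (Fin n) → ℝ}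
  {x p : EuclideanSpace ℝ (Fin n)} {ε : ℝ}

lemma exists_ball_of_eventually_punctured {P : EuclideanSpace ℝ (Fin n) → Prop}
    (h : ∀ᶠ y in 𝓝[K \ {x}] x, P y) : ∃ δ > 0, ∀ y ∈ K, y ≠ x → ‖y - x‖ < δ → P y := by
  obtain ⟨δ, hδ, hP⟩ := Metric.eventually_nhds_iff.1 (eventually_nhdsWithin_iff.1 h)
  exact ⟨δ, hδ, fun y hy hyx hlt => hP (by rwa [dist_eq_norm]) ⟨hy, hyx⟩⟩

lemma exists_ball_of_mem_subdifferential (hp : p ∈ subdifferential K V x) (hε : 0 < ε) :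
    ∃ δ > 0, ∀ y ∈ K, ‖y - x‖ < δ → inner ℝ p (y - x) - ε * ‖y - x‖ ≤ V y - V x := by
  have h0 : ((-ε : ℝ) : EReal) < liminf (diffQuotient V x p) (𝓝[K \ {x}] x) :=
    lt_of_lt_of_le (by exact_mod_cast neg_lt_zero.2 hε) hp
  obtain ⟨δ, hδ, h⟩ := exists_ball_of_eventually_punctured (eventually_lt_of_lt_liminf h0)
  refine ⟨δ, hδ, fun y hy hlt => ?_⟩
  -- A trajectory may sit at `x`, the point that the definition leaves out.
  rcases eq_or_ne y x with rfl | hyx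
  · simp
  · have h1 := h y hy hyx hlt
    rw [diffQuotient, EReal.coe_lt_coe_iff,
      lt_div_iff₀ (norm_pos_iff.2 (sub_ne_zero.2 hyx))] at h1
    linarith

lemma exists_ball_of_mem_superdifferential (hp : p ∈ superdifferential K V x) (hε : 0 < ε) :
    ∃ δ > 0, ∀ y ∈ K, ‖y - x‖ < δ → V y - V x ≤ inner ℝ p (y - x) + ε * ‖y - x‖ := by
  have h0 : limsup (diffQuotient V x p) (𝓝[K \ {x}] x) < ((ε : ℝ) : EReal) :=
    lt_of_le_of_lt hp (by exact_mod_cast hε)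
  obtain ⟨δ, hδ, h⟩ := exists_ball_of_eventually_punctured (eventually_lt_of_limsup_lt h0)
  refine ⟨δ, hδ, fun y hy hlt => ?_⟩
  rcases eq_or_ne y x with rfl | hyx
  · simp
  · have h1 := h y hy hyx hlt
    rw [diffQuotient, EReal.coe_lt_coe_iff,
      div_lt_iff₀ (norm_pos_iff.2 (sub_ne_zero.2 hyx))] at h1
    linarith

end Semidifferential

/-! ### From the dynamic programming principle to the Hamilton-Jacobi equation -/

/-- Freezing the state at the initial point costs `O(t²)` in the displacement. -/
lemma IsTrajectory.norm_sub_sub_integral_le (hC : 0 ≤ C)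
    (hf_cont : Continuous (Function.uncurry f))
    (hf_bdd : ∀ x a, ‖f x a‖ ≤ C) (hf_lip : ∀ x y a, ‖f x a - f y a‖ ≤ C * ‖x - y‖)
    {x : EuclideanSpace ℝ (Fin n)} {α : ℝ → A} (hα : Measurable α)
    {X : ℝ → EuclideanSpace ℝ (Fin n)} (hX : IsTrajectory f x α X) {t : ℝ} (ht : 0 ≤ t) :
    ‖X t - x - ∫ s in (0 : ℝ)..t, f x (α s)‖ ≤ C * (C * t) * t := by
  rw [hX.2 t ht, add_sub_cancel_left, ← intervalIntegral.integral_sub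
    (intervalIntegrable_along hf_cont hf_bdd hX.1 hα le_rfl ht)
    (intervalIntegrable_along hf_cont hf_bdd (X := fun _ => x) continuousOn_const hα le_rfl ht)]
  have h := intervalIntegral.norm_integral_le_of_norm_le_const (a := 0) (b := t)
    (f := fun s => f (X s) (α s) - f x (α s)) (C := C * (C * t)) fun s hs => by
      rw [uIoc_of_le ht] at hs
      refine (hf_lip _ _ _).trans (mul_le_mul_of_nonneg_left ?_ hC)
      exact (hX.norm_sub_le hf_bdd hs.1.le).trans (mul_le_mul_of_nonneg_left hs.2 hC)
  rwa [sub_zero, abs_of_nonneg ht] at h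

lemma bddAbove_range_inner {A : Type*}
    {f : EuclideanSpace ℝ (Fin n) → A → EuclideanSpace ℝ (Fin n)} (hf_bdd : ∀ x a, ‖f x a‖ ≤ C) (x p : EuclideanSpace ℝ (Fin n)) :
    BddAbove (range fun a => inner ℝ (f x a) p) := by
  refine ⟨C * ‖p‖, ?_⟩
  rintro _ ⟨a, rfl⟩
  exact (real_inner_le_norm _ _).trans (mul_le_mul_of_nonneg_right (hf_bdd x a) (norm_nonneg _))

lemma exists_small_time (c d : ℝ) {ε δ : ℝ} (hε : 0 < ε) (hδ : 0 < δ) :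
    ∃ t > 0, c * t < ε ∧ d * t < δ := by
  have h1 : ∀ᶠ t in 𝓝[>] (0 : ℝ), c * t < ε :=
    ((by fun_prop : Continuous fun t : ℝ => c * t).tendsto' 0 0 (by simp)).eventually_lt_const hε
      |>.filter_mono nhdsWithin_le_nhds
  have h2 : ∀ᶠ t in 𝓝[>] (0 : ℝ), d * t < δ :=
    ((by fun_prop : Continuous fun t : ℝ => d * t).tendsto' 0 0 (by simp)).eventually_lt_const hδ
      |>.filter_mono nhdsWithin_le_nhds
  obtain ⟨t, ⟨h1, h2⟩, ht⟩ := ((h1.and h2).and self_mem_nhdsWithin).exists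
  exact ⟨t, ht, h1, h2⟩

variable {K : Set (EuclideanSpace ℝ (Fin n))} {v : EuclideanSpace ℝ (Fin n) → ℝ}

/-- A function that can be kept from increasing by more than any prescribed amount, along a suitable
trajectory and up to any prescribed time, is a supersolution. -/
theorem isViscositySupersolution_of_exists_trajectory (hC : 0 ≤ C)
    (hf_cont : Continuous (Function.uncurry f))
    (hf_bdd : ∀ x a, ‖f x a‖ ≤ C) (hf_lip : ∀ x y a, ‖f x a - f y a‖ ≤ C * ‖x - y‖)
    (hK : IsInvariant f K)
    (hv : ∀ x ∈ K, ∀ T, 0 ≤ T → ∀ ε, 0 < ε → ∃ α X, Measurable α ∧ IsTrajectory f x α X ∧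
      v (X T) ≤ v x + ε) :
    IsViscositySupersolution K (fun x _ p => reducedHamiltonian f x (-p)) v := by
  intro x hx p hp
  refine le_of_forall_pos_le_add fun ε hε => ?_
  set h := reducedHamiltonian f x (-p) with h_def
  set ε' := ε / (2 * (C + 1)) with hε'_def
  have hε' : 0 < ε' := by positivity
  have hεC : ε' * C ≤ ε / 2 := by
    rw [hε'_def, div_mul_eq_mul_div, div_le_div_iff₀ (by positivity) two_pos]
    nlinarith
  obtain ⟨δ, hδ, hball⟩ := exists_ball_of_mem_subdifferential hp hε'
  obtain ⟨t, ht, ht1, ht2⟩ := exists_small_time (‖p‖ * (C * C) + 1) C (half_pos hε) hδ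
  -- The allowed increase `t * t` is negligible with respect to the time `t`.
  obtain ⟨α, X, hα, hX, hXv⟩ := hv x hx t ht.le (t * t) (mul_pos ht ht)
  have hXx := hX.norm_sub_le hf_bdd ht.le
  have h1 := hball (X t) (hK x hx α hα X hX t ht.le) (hXx.trans_lt ht2)
  have hfi : IntervalIntegrable (fun s => f x (α s)) volume 0 t :=
    intervalIntegrable_along hf_cont hf_bdd (X := fun _ => x) continuousOn_const hα le_rfl ht.le
  have h2 : -h * t ≤ inner ℝ p (∫ s in (0 : ℝ)..t, f x (α s)) := by
    have h3 := (innerSL ℝ p).intervalIntegral_comp_comm hfi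
    have h4 : ∫ _ in (0 : ℝ)..t, -h ≤ ∫ s in (0 : ℝ)..t, innerSL ℝ p (f x (α s)) := by
      refine intervalIntegral.integral_mono_on ht.le intervalIntegrable_const
        ⟨(innerSL ℝ p).integrable_comp hfi.1, (innerSL ℝ p).integrable_comp hfi.2⟩ fun s _ => ?_
      have h5 : inner ℝ (f x (α s)) (-p) ≤ h := le_ciSup (bddAbove_range_inner hf_bdd x (-p)) (α s)
      rw [inner_neg_right, real_inner_comm] at h5
      rw [innerSL_apply_apply]
      linarith
    rw [h3, innerSL_apply_apply, intervalIntegral.integral_const, sub_zero, smul_eq_mul] at h4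
    linarith
  have h3 := (abs_le.1 ((abs_real_inner_le_norm p _).trans (mul_le_mul_of_nonneg_left
    (hX.norm_sub_sub_integral_le hC hf_cont hf_bdd hf_lip hα ht.le) (norm_nonneg p)))).1
  rw [inner_sub_right] at h3
  have h4 : ε' * ‖X t - x‖ ≤ ε / 2 * t :=
    calc ε' * ‖X t - x‖ ≤ ε' * (C * t) := by gcongr
      _ = ε' * C * t := by ring
      _ ≤ ε / 2 * t := by gcongr
  have h5 : -h * t ≤ ε * t := by nlinarith
  linarith [le_of_mul_le_mul_right h5 ht]

/-- A function that is nondecreasing along every trajectory is a subsolution: this is tested with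
constant controls. -/
theorem isViscositySubsolution_of_le_along [Nonempty A] (hC : 0 ≤ C)
    (hf_cont : Continuous (Function.uncurry f))
    (hf_bdd : ∀ x a, ‖f x a‖ ≤ C) (hf_lip : ∀ x y a, ‖f x a - f y a‖ ≤ C * ‖x - y‖)
    (hK : IsInvariant f K)
    (hv : ∀ x ∈ K, ∀ α, Measurable α → ∀ X, IsTrajectory f x α X → ∀ T, 0 ≤ T → v x ≤ v (X T)) :
    IsViscositySubsolution K (fun x _ p => reducedHamiltonian f x (-p)) v := by
  intro x hx p hp
  refine ciSup_le fun a => ?_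
  rw [inner_neg_right, real_inner_comm]
  refine le_of_forall_pos_le_add fun ε hε => ?_
  set ε' := ε / (2 * (C + 1)) with hε'_def
  have hε' : 0 < ε' := by positivity
  have hεC : ε' * C ≤ ε / 2 := by
    rw [hε'_def, div_mul_eq_mul_div, div_le_div_iff₀ (by positivity) two_pos]
    nlinarith
  obtain ⟨δ, hδ, hball⟩ := exists_ball_of_mem_superdifferential hp hε'
  obtain ⟨t, ht, ht1, ht2⟩ := exists_small_time (‖p‖ * (C * C)) C (half_pos hε) hδ
  have hα : Measurable fun _ : ℝ => a := measurable_const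
  obtain ⟨X, hX⟩ := exists_isTrajectory hC hf_cont hf_bdd hf_lip x hα
  have hXx := hX.norm_sub_le hf_bdd ht.le
  have h1 := hball (X t) (hK x hx _ hα X hX t ht.le) (hXx.trans_lt ht2)
  have h2 := hv x hx _ hα X hX t ht.le
  have h3 := (abs_le.1 ((abs_real_inner_le_norm p _).trans (mul_le_mul_of_nonneg_left
    (hX.norm_sub_sub_integral_le hC hf_cont hf_bdd hf_lip hα ht.le) (norm_nonneg p)))).2
  rw [inner_sub_right, intervalIntegral.integral_const, sub_zero, inner_smul_right] at h3
  have h4 : ε' * ‖X t - x‖ ≤ ε / 2 * t :=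
    calc ε' * ‖X t - x‖ ≤ ε' * (C * t) := by gcongr
      _ = ε' * C * t := by ring
      _ ≤ ε / 2 * t := by gcongr
  have h5 : -inner ℝ p (f x a) * t ≤ ε * t := by nlinarith
  linarith [le_of_mul_le_mul_right h5 ht]

/-! ### The vanishing discount limit -/

lemma IsUniformClusterPoint.exists_lt {W : ℝ → EuclideanSpace ℝ (Fin n) → ℝ}
    (h : IsUniformClusterPoint K W v) {ε : ℝ} (hε : 0 < ε) :
    ∃ lam, 0 < lam ∧ lam < ε ∧ ∀ x ∈ K, |W lam x - v x| < ε := by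
  obtain ⟨lam, hlt, hmem⟩ := ((h ε hε).and_eventually (Ioo_mem_nhdsGT hε)).exists
  exact ⟨lam, hmem.1, hmem.2, hlt⟩

end VanishingDiscount

open VanishingDiscount in
theorem proposition3p1 {n : ℕ} {A : Type*} [MetricSpace A] [CompleteSpace A] [Nonempty A]
    [MeasurableSpace A] [BorelSpace A]
    (f : EuclideanSpace ℝ (Fin n) → A → EuclideanSpace ℝ (Fin n))
    (L : EuclideanSpace ℝ (Fin n) → A → ℝ) (C k : ℝ) (hC : 0 ≤ C) (hk : 0 ≤ k)
    (hf_cont : Continuous (Function.uncurry f))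
    (hf_bdd : ∀ x a, ‖f x a‖ ≤ C)
    (hf_lip : ∀ x y a, ‖f x a - f y a‖ ≤ C * ‖x - y‖)
    (hL_cont : Continuous (Function.uncurry L))
    (hL_bdd : ∀ x a, 0 ≤ L x a ∧ L x a ≤ 1)
    (hL_lip : ∀ x y a, |L x a - L y a| ≤ k * ‖x - y‖)
    (hconv : ∀ x, Convex ℝ {q : EuclideanSpace ℝ (Fin n) × ℝ |
      ∃ (a : A) (r : ℝ), 0 ≤ r ∧ q = (f x a, L x a + r)})
    (Ω : Set (EuclideanSpace ℝ (Fin n))) (hΩ_open : IsOpen Ω)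
    (hΩ_bdd : Bornology.IsBounded Ω)
    (hΩ_inv : VanishingDiscount.IsInvariant f (closure Ω))
    (v : EuclideanSpace ℝ (Fin n) → ℝ)
    (hv : VanishingDiscount.IsUniformClusterPoint (closure Ω)
      (fun lam x => lam * VanishingDiscount.valueFunction f L lam x) v) :
    VanishingDiscount.IsViscositySolution (closure Ω)
      (fun x _ p => VanishingDiscount.reducedHamiltonian f x (-p)) v := by
  refine ⟨?_, ?_, ?_⟩
  · refine continuousOn_of_uniform_approx_of_continuousOn fun U hU => ?_
    obtain ⟨ε, hε, hεU⟩ := Metric.mem_uniformity_dist.1 hU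
    obtain ⟨lam, hlam, -, hlt⟩ := hv.exists_lt hε
    refine ⟨_, (continuous_mul_valueFunction hC hk hf_cont hf_bdd hf_lip hL_cont hL_bdd hL_lip
      hlam).continuousOn, fun x hx => hεU ?_⟩
    rw [dist_comm, Real.dist_eq]
    exact hlt x hx
  · refine isViscositySupersolution_of_exists_trajectory hC hf_cont hf_bdd hf_lip hΩ_inv
      fun x hx T hT ε hε => ?_
    obtain ⟨lam, hlam, hlamε, hlt⟩ := hv.exists_lt (ε := ε / (T + 3)) (by positivity)
    obtain ⟨α, X, hα, hX, hle⟩ := exists_trajectory_mul_valueFunction_le hC hf_cont hf_bdd hf_lip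
      hL_cont hL_bdd hlam x hT (η := ε / (T + 3)) (by positivity)
    refine ⟨α, X, hα, hX, ?_⟩
    have h1 := (abs_lt.1 (hlt x hx)).2
    have h2 := (abs_lt.1 (hlt _ (hΩ_inv x hx α hα X hX T hT))).1
    have h3 : lam * T ≤ ε / (T + 3) * T := by gcongr
    have h4 : ε / (T + 3) * (T + 3) = ε := by field_simp
    linarith
  · refine isViscositySubsolution_of_le_along hC hf_cont hf_bdd hf_lip hΩ_inv
      fun x hx α hα X hX T hT => le_of_forall_pos_le_add fun ε hε => ?_
    obtain ⟨lam, hlam, hlamε, hlt⟩ := hv.exists_lt (ε := ε / (T + 2)) (by positivity)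
    have hle := mul_valueFunction_le_along hC hf_cont hf_bdd hf_lip hL_cont hL_bdd hlam hα hX hT
    have h1 := (abs_lt.1 (hlt x hx)).1
    have h2 := (abs_lt.1 (hlt _ (hΩ_inv x hx α hα X hX T hT))).2
    have h3 : lam * T ≤ ε / (T + 2) * T := by gcongr
    have h4 : ε / (T + 2) * (T + 2) = ε := by field_simp
    linarith
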